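/- Let $\mathbb{K}$ be a field of characteristic zero, let $l\ge 0$, and let $S=\mathbb{K}[x_1,\dots,x_l]$. Let $\mathcal{A}$ be a central hyperplane arrangement in $\mathbb{K}^l$, that is, a finite set of hyperplanes of $\mathbb{K}^l$ containing the origin. For each $H\in\mathcal{A}$ fix a homogeneous linear polynomial $\alpha_H\in S$ whose zero set is $H$, and put $Q(\mathcal{A})=\prod_{H\in\mathcal{A}}\alpha_H$. Let $J(\mathcal{A})\subseteq S$ be the Jacobian ideal, generated by $Q(\mathcal{A})$ and all its partial derivatives. Let $L(\mathcal{A})$ be the set of all intersections of subsets of $\mathcal{A}$ (the flats; the empty intersection is $\mathbb{K}^l$), and let the rank of a flat be its codimension. For a flat $X$ let $\mathcal{A}_X=\{H\in\mathcal{A}\mid X\subseteq H\}$ be the localization and let $I(X)\subseteq S$ be the ideal generated by the $\alpha_H$ with $H\in\mathcal{A}_X$. An arrangement $\mathcal{B}$ is called free if the $S$-module $$D(\mathcal{B})=\{\delta\in\mathrm{Der}_{\mathbb{K}}(S)\mid \delta(\alpha_H)\in\alpha_H S\text{ for all }H\in\mathcal{B}\}$$ is free. Then $$\mathrm{Ass}_S(S/J(\mathcal{A}))\subseteq\{I(X)\mid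 X\in L(\mathcal{A}),\ \operatorname{rank}X=2\}\cup\{I(X)\mid X\in L(\mathcal{A}),\ \operatorname{rank}X\ge 3,\ \mathcal{A}_X\text{ is not free}\}.$$ -/

import Mathlib

/-- A central hyperplane arrangement in `K^l`: a finite set of linear hyperplanes, together with
a fixed choice of a homogeneous linear polynomial defining each of them. -/
structure CentralArrangement (K : Type*) [Field K] (l : ℕ) where
  /-- The hyperplanes of the arrangement. -/
  hyperplanes : Finset (Submodule K (Fin l → K))
  /-- Each member has codimension one. -/
  finrank_add_one : ∀ H ∈ hyperplanes, Module.finrank K H + 1 = l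
  /-- The defining polynomial `α_H`; only its values at members of the arrangement matter. -/
  form : Submodule K (Fin l → K) → MvPolynomial (Fin l) K
  isHomogeneous_form : ∀ H ∈ hyperplanes, (form H).IsHomogeneous 1
  /-- `H` is the zero set of `α_H`. -/
  mem_iff_eval_form : ∀ H ∈ hyperplanes, ∀ v : Fin l → K,
    v ∈ H ↔ MvPolynomial.eval v (form H) = 0

namespace CentralArrangement

variable {K : Type*} [Field K] {l : ℕ}

/-- The defining polynomial `Q(A)`, the product of all `α_H`. -/
noncomputable def Q (A : CentralArrangement K l) : MvPolynomial (Fin l) K :=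
  ∏ H ∈ A.hyperplanes, A.form H

/-- The Jacobian ideal `J(A)`, generated by `Q(A)` and all its partial derivatives. -/
noncomputable def jacobianIdeal (A : CentralArrangement K l) : Ideal (MvPolynomial (Fin l) K) :=
  Ideal.span ({A.Q} ∪ Set.range fun i : Fin l => MvPolynomial.pderiv i A.Q)

/-- The intersection lattice `L(A)`: all intersections of subsets of the arrangement (the empty
intersection being the whole space). -/
def flats (A : CentralArrangement K l) : Set (Submodule K (Fin l → K)) :=
  {X | ∃ B : Finset (Submodule K (Fin l → K)), B ⊆ A.hyperplanes ∧ X = B.inf id}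

/-- The rank of a subspace of `K^l` is its codimension. -/
noncomputable def rank (X : Submodule K (Fin l → K)) : ℕ :=
  Module.finrank K ((Fin l → K) ⧸ X)

open scoped Classical in
/-- The localization `A_X`, consisting of the hyperplanes of `A` that contain `X`. -/
noncomputable def localization (A : CentralArrangement K l) (X : Submodule K (Fin l → K)) :
    CentralArrangement K l where
  hyperplanes := A.hyperplanes.filter fun H => X ≤ H
  finrank_add_one H hH := A.finrank_add_one H (Finset.mem_filter.1 hH).1
  form := A.form
  isHomogeneous_form H hH := A.isHomogeneous_form H (Finset.mem_filter.1 hH).1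
  mem_iff_eval_form H hH := A.mem_iff_eval_form H (Finset.mem_filter.1 hH).1

/-- The ideal `I(X)` of a flat `X`, generated by the `α_H` of the hyperplanes `H` of `A` that
contain `X`. Any hyperplanes of `A` with intersection `X` already give generators, since the linear
forms vanishing on their intersection are the linear combinations of their defining forms. -/
noncomputable def flatIdeal (A : CentralArrangement K l) (X : Submodule K (Fin l → K)) :
    Ideal (MvPolynomial (Fin l) K) :=
  Ideal.span (A.form '' {H | H ∈ A.hyperplanes ∧ X ≤ H})

/-- The module `D(A)` of logarithmic vector fields: the polynomial vector fields `δ` on `K^l`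
with `δ(α_H) ∈ ⟨α_H⟩` for all `H` in `A`. -/
def logDer (A : CentralArrangement K l) :
    Submodule (MvPolynomial (Fin l) K)
      (Derivation K (MvPolynomial (Fin l) K) (MvPolynomial (Fin l) K)) where
  carrier := {δ | ∀ H ∈ A.hyperplanes, δ (A.form H) ∈ Ideal.span {A.form H}}
  zero_mem' _ _ := Ideal.zero_mem _
  add_mem' h₁ h₂ H hH := Ideal.add_mem _ (h₁ H hH) (h₂ H hH)
  smul_mem' f _ h H hH := Ideal.mul_mem_left _ f (h H hH)

/-- `A` is free if `D(A)` is a free module over the polynomial ring. No grading is imposed on the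
basis, so that failing to be free says in particular that there is no homogeneous basis. -/
def IsFree (A : CentralArrangement K l) : Prop :=
  Module.Free (MvPolynomial (Fin l) K) A.logDer

end CentralArrangement

/-! Write an associated prime as `P = (J(Q) : f)` and let `X` be the intersection of the hyperplanes
whose forms lie in `P`. Then `Q = Q_X * g` with `g ∉ P`, and `g ^ 2 J(Q_X) ⊆ J(Q) ⊆ J(Q_X)`, so also
`P = (J(Q_X) : f)`, and `I(X) ⊆ P`.

In coordinates adapted to `X`, `Q_X` involves only those vanishing on `X`, so `J(Q_X)` is extended
from a smaller polynomial ring whose irrelevant ideal generates `I(X)`. An element killed by `I(X)`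
and nonzero modulo `J(Q_X)` has no larger annihilator (`mem_map_C_of_mul_mem_map_C`), whence `P =
I(X)`.

In rank at most one `J(Q_X)` is the unit ideal. If `A_X` is free of rank at least three,
`mem_jacobian_of_mul_mem` forces `f ∈ J(Q_X)`. Behind it: the relations `c * q + δ q = 0` form a
module isomorphic to `D(A_X)`, so freeness gives `S/J(Q_X)` a free resolution of length two, too
short for three regular elements to kill a nonzero class. The proof is an explicit Koszul chase. -/

open MvPolynomial

/-! ### Jacobian ideals: coordinate changes, factors and extra variables -/

section Jacobian

variable {K : Type*} [Field K] {σ τ : Type*}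

/-- The Jacobian ideal of a polynomial `q`, generated by `q` and its partial derivatives. -/
noncomputable def jacobian (q : MvPolynomial σ K) : Ideal (MvPolynomial σ K) :=
  Ideal.span ({q} ∪ Set.range fun i => pderiv i q)

theorem self_mem_jacobian (q : MvPolynomial σ K) : q ∈ jacobian q :=
  Ideal.subset_span (Or.inl rfl)

theorem pderiv_mem_jacobian (q : MvPolynomial σ K) (i : σ) : pderiv i q ∈ jacobian q :=
  Ideal.subset_span (Or.inr ⟨i, rfl⟩)

theorem jacobian_le_iff {q : MvPolynomial σ K} {I : Ideal (MvPolynomial σ K)} :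
    jacobian q ≤ I ↔ q ∈ I ∧ ∀ i, pderiv i q ∈ I := by
  rw [jacobian, Ideal.span_le, Set.union_subset_iff, Set.singleton_subset_iff,
    Set.range_subset_iff]
  rfl

theorem derivation_eq_sum_pderiv [Fintype σ]
    (D : Derivation K (MvPolynomial σ K) (MvPolynomial σ K)) (q : MvPolynomial σ K) :
    D q = ∑ i, D (X i) * pderiv i q := by
  classical
  have hsum (p : MvPolynomial σ K) :
      (∑ i, D (X i) • pderiv i : Derivation K (MvPolynomial σ K) (MvPolynomial σ K)) p =
        ∑ i, D (X i) * pderiv i p := by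
    rw [← Derivation.coeFnAddMonoidHom_apply, map_sum]
    simp
  rw [← hsum]
  congr 1
  refine derivation_ext fun j => ?_
  rw [hsum]
  simp [pderiv_X, Pi.single_apply]

theorem derivation_mem_jacobian [Fintype σ]
    (D : Derivation K (MvPolynomial σ K) (MvPolynomial σ K)) (q : MvPolynomial σ K) :
    D q ∈ jacobian q := by
  rw [derivation_eq_sum_pderiv]
  exact Ideal.sum_mem _ fun i _ => Ideal.mul_mem_left _ _ (pderiv_mem_jacobian q i)

/-- This description does not mention coordinates, so it passes through algebra isomorphisms; it
also feeds the Koszul argument. -/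
theorem exists_derivation_of_mem_jacobian {q f : MvPolynomial σ K} (hf : f ∈ jacobian q) :
    ∃ (c : MvPolynomial σ K) (D : Derivation K (MvPolynomial σ K) (MvPolynomial σ K)),
      f = c * q + D q := by
  induction hf using Submodule.span_induction with
  | mem x h =>
    rcases h with rfl | ⟨i, rfl⟩
    · exact ⟨1, 0, by simp⟩
    · exact ⟨0, pderiv i, by simp⟩
  | zero => exact ⟨0, 0, by simp⟩
  | add x y _ _ hx hy =>
    obtain ⟨c, D, rfl⟩ := hx
    obtain ⟨c', D', rfl⟩ := hy
    exact ⟨c + c', D + D', by simp only [Derivation.add_apply]; ring⟩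
  | smul a x _ hx =>
    obtain ⟨c, D, rfl⟩ := hx
    exact ⟨a * c, a • D, by simp only [Derivation.smul_apply, smul_eq_mul]; ring⟩

/-- Transport of a derivation along an isomorphism of algebras. -/
def derivationConj {A B : Type*} [CommRing A] [Algebra K A] [CommRing B] [Algebra K B]
    (e : A ≃ₐ[K] B) (D : Derivation K A A) : Derivation K B B :=
  Derivation.mk' (e.toLinearMap ∘ₗ D.toLinearMap ∘ₗ e.symm.toLinearMap) fun a b => by
    simp

theorem derivationConj_apply {A B : Type*} [CommRing A] [Algebra K A] [CommRing B] [Algebra K B]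
    (e : A ≃ₐ[K] B) (D : Derivation K A A) (a : A) : derivationConj e D (e a) = e (D a) := by
  change e (D (e.symm (e a))) = e (D a)
  rw [e.symm_apply_apply]

theorem algEquiv_mem_jacobian [Fintype τ] (e : MvPolynomial σ K ≃ₐ[K] MvPolynomial τ K)
    {q f : MvPolynomial σ K} (hf : f ∈ jacobian q) : e f ∈ jacobian (e q) := by
  obtain ⟨c, D, rfl⟩ := exists_derivation_of_mem_jacobian hf
  rw [map_add, map_mul, ← derivationConj_apply]
  exact Ideal.add_mem _ (Ideal.mul_mem_left _ _ (self_mem_jacobian _))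
    (derivation_mem_jacobian _ _)

theorem algEquiv_mem_jacobian_iff [Fintype σ] [Fintype τ]
    (e : MvPolynomial σ K ≃ₐ[K] MvPolynomial τ K) {q f : MvPolynomial σ K} :
    e f ∈ jacobian (e q) ↔ f ∈ jacobian q :=
  ⟨fun h => by simpa using algEquiv_mem_jacobian e.symm h, algEquiv_mem_jacobian e⟩

theorem jacobian_mul_le (q g : MvPolynomial σ K) : jacobian (q * g) ≤ jacobian q := by
  refine jacobian_le_iff.2 ⟨Ideal.mul_mem_right _ _ (self_mem_jacobian q), fun i => ?_⟩
  rw [pderiv_mul]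
  exact Ideal.add_mem _ (Ideal.mul_mem_right _ _ (pderiv_mem_jacobian q i))
    (Ideal.mul_mem_right _ _ (self_mem_jacobian q))

/-- One factor `g` turns `∂q` into `∂(q * g)` up to the term `q * ∂g`; the second makes that term a
multiple of `q * g`. Hence inverting `g` identifies the two Jacobian ideals. -/
theorem sq_mul_mem_jacobian_mul {q f : MvPolynomial σ K} (g : MvPolynomial σ K)
    (hf : f ∈ jacobian q) : g ^ 2 * f ∈ jacobian (q * g) := by
  obtain ⟨hq, hd⟩ := jacobian_le_iff.1 (le_refl (jacobian (q * g)))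
  induction hf using Submodule.span_induction with
  | mem x h =>
    rcases h with rfl | ⟨i, rfl⟩
    · rw [show g ^ 2 * x = g * (x * g) by ring]
      exact Ideal.mul_mem_left _ _ hq
    · have h : g ^ 2 * pderiv i q = g * pderiv i (q * g) - pderiv i g * (q * g) := by
        rw [pderiv_mul]; ring
      simp only [h]
      exact Ideal.sub_mem _ (Ideal.mul_mem_left _ _ (hd i)) (Ideal.mul_mem_left _ _ hq)
  | zero => simp
  | add x y _ _ hx hy => rw [mul_add]; exact Ideal.add_mem _ hx hy
  | smul a x _ hx =>
    rw [smul_eq_mul, mul_left_comm]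
    exact Ideal.mul_mem_left _ _ hx

theorem map_sumAlgEquiv_jacobian_rename_inr (q : MvPolynomial τ K) :
    (jacobian (rename (Sum.inr : τ → σ ⊕ τ) q)).map (sumAlgEquiv K σ τ) =
      (jacobian q).map (C : MvPolynomial τ K →+* MvPolynomial σ (MvPolynomial τ K)) := by
  have hC (p : MvPolynomial τ K) : sumAlgEquiv K σ τ (rename Sum.inr p) = C p :=
    DFunLike.congr_fun (sumAlgEquiv_comp_rename_inr (R := K) (S₁ := σ) (S₂ := τ)) p
  apply le_antisymm
  · rw [Ideal.map_le_iff_le_comap, jacobian_le_iff]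
    refine ⟨?_, ?_⟩
    · rw [Ideal.mem_comap, hC]
      exact Ideal.mem_map_of_mem _ (self_mem_jacobian q)
    · rintro (i | i)
      · rw [pderiv_eq_zero_of_notMem_vars]
        · exact Ideal.zero_mem _
        · classical
          intro h
          obtain ⟨j, -, hj⟩ := Finset.mem_image.1 (vars_rename _ _ h)
          exact Sum.inr_ne_inl hj
      · rw [pderiv_rename Sum.inr_injective, Ideal.mem_comap, hC]
        exact Ideal.mem_map_of_mem _ (pderiv_mem_jacobian q i)
  · rw [Ideal.map_le_iff_le_comap, jacobian_le_iff]
    refine ⟨?_, fun i => ?_⟩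
    · rw [Ideal.mem_comap, ← hC]
      exact Ideal.mem_map_of_mem _ (self_mem_jacobian _)
    · rw [Ideal.mem_comap, ← hC, ← pderiv_rename Sum.inr_injective]
      exact Ideal.mem_map_of_mem _ (pderiv_mem_jacobian _ _)

/-- The polynomial ring over `R` is torsion free over that over `K` modulo ideals of `R`: if the
ideal `m` kills `f` modulo `I` and `R = K + m`, then the annihilator of `f` is extended from `m`. -/
theorem mem_map_C_of_mul_mem_map_C {R : Type*} [CommRing R] [Algebra K R] {I m : Ideal R}
    (hm : ∀ r : R, ∃ c : K, r - algebraMap K R c ∈ m) {f p : MvPolynomial σ R}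
    (hf : f ∉ I.map (C : R →+* MvPolynomial σ R))
    (hmf : ∀ r ∈ m, C r * f ∈ I.map (C : R →+* MvPolynomial σ R))
    (hp : p * f ∈ I.map (C : R →+* MvPolynomial σ R)) :
    p ∈ m.map (C : R →+* MvPolynomial σ R) := by
  classical
  choose c hc using hm
  -- Since `m` kills `f` modulo `I`, only the residue `p₀` of `p` over `K` matters.
  obtain ⟨p₀, hp₀⟩ : ∃ p₀ : MvPolynomial σ K,
      ∀ s, p.coeff s - algebraMap K R (p₀.coeff s) ∈ m := by
    refine ⟨∑ s ∈ p.support, monomial s (c (p.coeff s)), fun s => ?_⟩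
    simp only [coeff_sum, coeff_monomial, Finset.sum_ite_eq']
    split_ifs with h
    · exact hc _
    · simp [notMem_support_iff.1 h]
  rw [mem_map_C_iff] at hf hp
  push Not at hf
  obtain ⟨a, ha⟩ := hf
  obtain ⟨L₀, hL₀⟩ := Module.Projective.exists_dual_ne_zero K
    (x := Ideal.Quotient.mk I (f.coeff a)) (by rwa [Ne, Ideal.Quotient.eq_zero_iff_mem])
  -- A functional killing `I` but not some coefficient of `f` turns `p₀ * f ≡ 0` into `p₀ * g = 0`
  -- over the domain `K[σ]`, with `g ≠ 0`.
  let L : R →ₗ[K] K := L₀ ∘ₗ (Ideal.Quotient.mkₐ K I).toLinearMap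
  have hL (r : R) (hr : r ∈ I) : L r = 0 := by
    simp [L, Ideal.Quotient.eq_zero_iff_mem.2 hr]
  obtain ⟨g, hg⟩ : ∃ g : MvPolynomial σ K, ∀ s, g.coeff s = L (f.coeff s) := by
    refine ⟨∑ s ∈ f.support, monomial s (L (f.coeff s)), fun s => ?_⟩
    simp only [coeff_sum, coeff_monomial, Finset.sum_ite_eq']
    split_ifs with h
    · rfl
    · simp [notMem_support_iff.1 h]
  have hg0 : g ≠ 0 := fun h => hL₀ (by simpa [h, L] using (hg a).symm)
  have hpg : p₀ * g = 0 := by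
    ext n
    have h₁ := hp n
    have h₂ : ∑ x ∈ Finset.HasAntidiagonal.antidiagonal n,
        (p.coeff x.1 - algebraMap K R (p₀.coeff x.1)) * f.coeff x.2 ∈ I :=
      Ideal.sum_mem _ fun x _ => by
        simpa only [coeff_C_mul] using mem_map_C_iff.1 (hmf _ (hp₀ x.1)) x.2
    have h₃ := hL _ (Ideal.sub_mem _ h₁ h₂)
    rw [coeff_mul, ← Finset.sum_sub_distrib] at h₃
    rw [coeff_mul, coeff_zero, ← h₃, map_sum]
    refine Finset.sum_congr rfl fun x _ => ?_
    rw [hg, ← sub_mul, sub_sub_cancel, ← Algebra.smul_def, map_smul, smul_eq_mul]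
  have hp0 : p₀ = 0 := (mul_eq_zero.1 hpg).resolve_right hg0
  rw [mem_map_C_iff]
  intro s
  simpa [hp0] using hp₀ s

end Jacobian

/-! ### The Koszul argument for free modules of derivations -/

section Koszul

/-- The relations `y₃ w = y₁ a + y₂ b` force `w ∈ (y₁, y₂)` in a free module as soon as they do so
in the ring. -/
theorem Module.Free.exists_eq_smul_add_smul {S M : Type*} [CommRing S] [AddCommGroup M] [Module S M]
    [Module.Free S M] {y₁ y₂ y₃ : S}
    (h : ∀ w a b : S, y₃ * w = y₁ * a + y₂ * b → ∃ u v, w = y₁ * u + y₂ * v)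
    {w a b : M} (hw : y₃ • w = y₁ • a + y₂ • b) : ∃ u v : M, w = y₁ • u + y₂ • v := by
  let B := Module.Free.chooseBasis S M
  have hi (i) : ∃ u v, B.repr w i = y₁ * u + y₂ * v := by
    refine h _ (B.repr a i) (B.repr b i) ?_
    simpa using DFunLike.congr_fun (congrArg B.repr hw) i
  choose u v huv using hi
  refine ⟨∑ i ∈ (B.repr w).support, u i • B i, ∑ i ∈ (B.repr w).support, v i • B i, ?_⟩
  conv_lhs => rw [← B.linearCombination_repr w, Finsupp.linearCombination_apply, Finsupp.sum]
  rw [Finset.smul_sum, Finset.smul_sum, ← Finset.sum_add_distrib]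
  refine Finset.sum_congr rfl fun i _ => ?_
  rw [smul_smul, smul_smul, ← add_smul, ← huv]

namespace MvPolynomial

variable {K : Type*} [Field K] {σ : Type*}

/-- Membership in a monomial ideal is tested on the support, and multiplying by `X k` leaves the
exponents of `X i` and `X j` unchanged. -/
theorem exists_eq_X_mul_add_X_mul {i j k : σ} (hik : i ≠ k) (hjk : j ≠ k)
    {w a b : MvPolynomial σ K} (h : X k * w = X i * a + X j * b) :
    ∃ u v, w = X i * u + X j * v := by
  classical
  have hmem : X k * w ∈ Ideal.span (X '' {i, j} : Set (MvPolynomial σ K)) := by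
    rw [h, Set.image_pair]
    exact Ideal.mem_span_pair.2 ⟨a, b, by ring⟩
  have hw : w ∈ Ideal.span (X '' {i, j} : Set (MvPolynomial σ K)) := by
    rw [mem_ideal_span_X_image] at hmem ⊢
    intro m hm
    obtain ⟨t, ht, hmt⟩ := hmem (Finsupp.single k 1 + m) (by
      rw [mem_support_iff, coeff_X_mul]
      exact mem_support_iff.1 hm)
    refine ⟨t, ht, ?_⟩
    have htk : k ≠ t := by
      rcases ht with rfl | rfl
      · exact hik.symm
      · exact hjk.symm
    simpa [Finsupp.single_eq_of_ne' htk] using hmt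
  rw [Set.image_pair] at hw
  obtain ⟨u, v, huv⟩ := Ideal.mem_span_pair.1 hw
  exact ⟨u, v, by rw [← huv]; ring⟩

theorem X_dvd_of_dvd_X_mul {i j : σ} (hij : i ≠ j) {a : MvPolynomial σ K}
    (h : X i ∣ X j * a) : X i ∣ a := by
  refine ((X_prime (i := i)).dvd_or_dvd h).resolve_left fun h' => hij ?_
  rwa [X_dvd_X] at h'

/-- If the derivations preserving `(q)` form a free module and `y₁, y₂, y₃` is a regular sequence,
then no nonzero element of the Jacobian ring of `q` is killed by `y₁`, `y₂` and `y₃`. -/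
theorem mem_jacobian_of_mul_mem [Fintype σ] {q : MvPolynomial σ K} (hq : q ≠ 0)
    (D : Submodule (MvPolynomial σ K) (Derivation K (MvPolynomial σ K) (MvPolynomial σ K)))
    (hD : ∀ δ, δ ∈ D ↔ q ∣ δ q) [Module.Free (MvPolynomial σ K) D]
    {y₁ y₂ y₃ f : MvPolynomial σ K} (hy₁ : y₁ ≠ 0)
    (h₁₂ : ∀ a, y₁ ∣ y₂ * a → y₁ ∣ a)
    (h₁₂₃ : ∀ w a b, y₃ * w = y₁ * a + y₂ * b → ∃ u v, w = y₁ * u + y₂ * v)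
    (hf₁ : y₁ * f ∈ jacobian q) (hf₂ : y₂ * f ∈ jacobian q) (hf₃ : y₃ * f ∈ jacobian q) :
    f ∈ jacobian q := by
  obtain ⟨c₁, δ₁, e₁⟩ := exists_derivation_of_mem_jacobian hf₁
  obtain ⟨c₂, δ₂, e₂⟩ := exists_derivation_of_mem_jacobian hf₂
  obtain ⟨c₃, δ₃, e₃⟩ := exists_derivation_of_mem_jacobian hf₃
  have key {a b c c' : MvPolynomial σ K}
      {δ δ' : Derivation K (MvPolynomial σ K) (MvPolynomial σ K)}
      (h : a * f = c * q + δ q) (h' : b * f = c' * q + δ' q) : b • δ - a • δ' ∈ D := by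
    rw [hD]
    refine ⟨a * c' - b * c, ?_⟩
    simp only [Derivation.sub_apply, Derivation.smul_apply, smul_eq_mul]
    linear_combination a * h' - b * h
  -- With `θᵢⱼ = yⱼ δᵢ - yᵢ δⱼ ∈ D`, the Koszul identity is `y₃ θ₁₂ = -y₁ θ₂₃ + y₂ θ₁₃`.
  obtain ⟨⟨u, hu⟩, ⟨v, hv⟩, huv⟩ := Module.Free.exists_eq_smul_add_smul (M := D) h₁₂₃
    (w := ⟨_, key e₁ e₂⟩) (a := -⟨_, key e₂ e₃⟩) (b := ⟨_, key e₁ e₃⟩) (by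
      ext1
      simp only [Submodule.coe_smul, Submodule.coe_add, Submodule.coe_neg]
      module)
  have huv' : y₂ • δ₁ - y₁ • δ₂ = y₁ • u + y₂ • v := congrArg Subtype.val huv
  obtain ⟨d, hd⟩ := (hD u).1 hu
  obtain ⟨d', hd'⟩ := (hD v).1 hv
  -- Rearranged, `y₂ (δ₁ - v) = y₁ (δ₂ + u)`; regularity allows division of `δ₁ - v` by `y₁`.
  have hγ (i : σ) : y₁ ∣ (δ₁ - v) (X i) := by
    refine h₁₂ _ ⟨(δ₂ + u) (X i), ?_⟩
    have := DFunLike.congr_fun huv' (X i)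
    simp only [Derivation.sub_apply, Derivation.add_apply, Derivation.smul_apply,
      smul_eq_mul] at this ⊢
    linear_combination this
  choose γ hγ using hγ
  have hγ' : δ₁ - v = y₁ • mkDerivation K γ := derivation_ext fun i => by
    rw [hγ, Derivation.smul_apply, mkDerivation_X, smul_eq_mul]
  have hγq : δ₁ q - v q = y₁ * mkDerivation K γ q := DFunLike.congr_fun hγ' q
  have huvq : y₂ * δ₁ q - y₁ * δ₂ q = y₁ * u q + y₂ * v q := DFunLike.congr_fun huv' q
  -- Comparing the two expressions for `y₁ y₂ f` and cancelling `q` gives `y₂ (c₁ + d') = y₁ (c₂ -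
  -- d)`.
  obtain ⟨g, hg⟩ : y₁ ∣ c₁ + d' := by
    refine h₁₂ _ ⟨c₂ - d, mul_right_cancel₀ hq ?_⟩
    linear_combination y₁ * e₂ - y₂ * e₁ - huvq - y₂ * hd' - y₁ * hd
  have hfq : f = g * q + mkDerivation K γ q := by
    refine mul_left_cancel₀ hy₁ ?_
    linear_combination e₁ + q * hg + hγq + hd'
  rw [hfq]
  exact Ideal.add_mem _ (Ideal.mul_mem_left _ _ (self_mem_jacobian q))
    (derivation_mem_jacobian _ _)

end MvPolynomial

end Koszul

/-! ### Linear forms and adapted linear coordinates -/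

section LinearForm

variable {K : Type*} [Field K] {l : ℕ}

/-- The homogeneous linear polynomial of a linear functional. -/
noncomputable def linearForm : Module.Dual K (Fin l → K) →ₗ[K] MvPolynomial (Fin l) K where
  toFun φ := ∑ i, φ (Pi.single i 1) • X i
  map_add' φ ψ := by simp [add_smul, Finset.sum_add_distrib]
  map_smul' c φ := by simp [mul_smul, Finset.smul_sum]

theorem linearForm_apply (φ : Module.Dual K (Fin l → K)) :
    linearForm φ = ∑ i, φ (Pi.single i 1) • (X i : MvPolynomial (Fin l) K) := rfl

theorem sum_smul_single (v : Fin l → K) : ∑ i, v i • (Pi.single i 1 : Fin l → K) = v := by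
  ext j
  simp [Finset.sum_apply, Pi.single_apply]

theorem eval_linearForm (φ : Module.Dual K (Fin l → K)) (v : Fin l → K) :
    eval v (linearForm φ) = φ v := by
  conv_rhs => rw [← sum_smul_single v]
  simp [linearForm_apply, smul_eval, mul_comm]

/-- Euler's identity recovers `p` from its partial derivatives, which are constants. -/
theorem exists_linearForm_eq {p : MvPolynomial (Fin l) K} (hp : p.IsHomogeneous 1) :
    ∃ φ, linearForm φ = p := by
  have hc (i : Fin l) : ∃ c : K, pderiv i p = C c := by
    refine ⟨_, totalDegree_eq_zero_iff_eq_C.1 ?_⟩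
    exact (totalDegree_zero_iff_isHomogeneous (Fin l)).2 hp.pderiv
  choose c hc using hc
  refine ⟨∑ i, c i • LinearMap.proj i, ?_⟩
  have h := hp.sum_X_mul_pderiv
  rw [one_smul] at h
  rw [← h, linearForm_apply]
  refine Finset.sum_congr rfl fun i _ => ?_
  rw [hc, smul_eq_C_mul, mul_comm]
  congr 2
  simp [Pi.single_apply]

/-- The linear coordinates with respect to a basis of the affine space. -/
noncomputable def coordinateEquiv {σ : Type*} [Fintype σ] (b : Module.Basis σ K (Fin l → K)) :
    MvPolynomial σ K ≃ₐ[K] MvPolynomial (Fin l) K :=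
  AlgEquiv.ofAlgHom (aeval fun s => linearForm (b.coord s)) (aeval fun i => ∑ s, b s i • X s)
    (by
      ext1 i
      have h : (∑ s, b s i • b.coord s) = LinearMap.proj i := by
        refine LinearMap.ext fun v => ?_
        have hv := congrFun (b.sum_repr v) i
        simp only [Finset.sum_apply, Pi.smul_apply, smul_eq_mul] at hv
        simp [← hv, mul_comm]
      simp only [AlgHom.comp_apply, aeval_X, map_sum, map_smul, AlgHom.id_apply]
      simp only [← map_smul linearForm]
      rw [← map_sum, h, linearForm_apply]
      simp [Pi.single_apply])
    (by
      classical
      ext1 s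
      simp only [AlgHom.comp_apply, aeval_X, linearForm_apply, map_sum, map_smul,
        AlgHom.id_apply, Finset.smul_sum]
      rw [Finset.sum_comm]
      have h (t) : ∑ i, b.coord s (Pi.single i 1) • b t i • (X t : MvPolynomial σ K) =
          (if t = s then (1 : K) else 0) • X t := by
        simp only [smul_smul]
        rw [← Finset.sum_smul]
        congr 1
        conv_rhs => rw [← Finsupp.single_apply, ← b.repr_self t, ← b.coord_apply,
          ← sum_smul_single (b t)]
        simp [mul_comm]
      simp only [h]
      simp)

theorem coordinateEquiv_X {σ : Type*} [Fintype σ] (b : Module.Basis σ K (Fin l → K)) (s : σ) :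
    coordinateEquiv b (X s) = linearForm (b.coord s) := by
  simp [coordinateEquiv]

theorem linearForm_eq_coordinateEquiv {σ : Type*} [Fintype σ]
    (b : Module.Basis σ K (Fin l → K)) (φ : Module.Dual K (Fin l → K)) :
    linearForm φ = coordinateEquiv b (∑ s, φ (b s) • X s) := by
  simp only [map_sum, map_smul, coordinateEquiv_X]
  simp only [← map_smul linearForm]
  rw [← map_sum]
  congr 1
  refine b.ext fun t => ?_
  simp

/-- A basis of `K^l` whose first part is a basis of the given subspace. -/
theorem exists_basis_adapted (W : Submodule K (Fin l → K)) :
    ∃ b : Module.Basis (Fin (Module.finrank K W) ⊕ Fin (Module.finrank K ((Fin l → K) ⧸ W)))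
      K (Fin l → K), (∀ i, b (Sum.inl i) ∈ W) ∧ ∀ w ∈ W, ∀ t, b.coord (Sum.inr t) w = 0 := by
  obtain ⟨Y, hY⟩ := W.exists_isCompl
  let bY := (Module.finBasis K ((Fin l → K) ⧸ W)).map (W.quotientEquivOfIsCompl Y hY)
  refine ⟨((Module.finBasis K W).prod bY).map (W.prodEquivOfIsCompl Y hY), fun i => ?_,
    fun w hw t => ?_⟩
  · simp
  · have h : (W.prodEquivOfIsCompl Y hY).symm w = ((⟨w, hw⟩ : W), (0 : Y)) :=
      Submodule.prodEquivOfIsCompl_symm_apply_left W Y hY ⟨w, hw⟩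
    simp [Module.Basis.coord_apply, h]

theorem prime_linearForm {φ : Module.Dual K (Fin l → K)} (hφ : φ ≠ 0) :
    Prime (linearForm φ) := by
  have h0 : linearForm φ ≠ 0 := fun h => hφ (LinearMap.ext fun v => by
    rw [← eval_linearForm, h, map_zero, LinearMap.zero_apply])
  have hom : (linearForm φ).IsHomogeneous 1 := by
    rw [linearForm_apply]
    refine IsHomogeneous.sum _ _ _ fun i _ => ?_
    rw [smul_eq_C_mul]
    simpa using (isHomogeneous_C (Fin l) _).mul (isHomogeneous_X K i)
  refine (irreducible_of_totalDegree_eq_one (hom.totalDegree h0) fun x hx => ?_).prime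
  refine isUnit_iff_ne_zero.2 fun hx0 => h0 ?_
  ext i
  simpa [hx0] using hx i

end LinearForm

/-! ### Localizations of arrangements and their Jacobian ideals -/

namespace CentralArrangement

variable {K : Type*} [Field K] {l : ℕ} (A : CentralArrangement K l)

theorem exists_linearForm_eq_form {H : Submodule K (Fin l → K)} (hH : H ∈ A.hyperplanes) :
    ∃ φ : Module.Dual K (Fin l → K), A.form H = linearForm φ ∧ LinearMap.ker φ = H ∧ φ ≠ 0 := by
  obtain ⟨φ, hφ⟩ := exists_linearForm_eq (A.isHomogeneous_form H hH)
  have hker : LinearMap.ker φ = H := by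
    ext v
    rw [A.mem_iff_eval_form H hH v, ← hφ, eval_linearForm, LinearMap.mem_ker]
  refine ⟨φ, hφ.symm, hker, ?_⟩
  rintro rfl
  have h := A.finrank_add_one H hH
  rw [← hker, LinearMap.ker_zero, finrank_top, Module.finrank_fin_fun] at h
  omega

theorem prime_form {H : Submodule K (Fin l → K)} (hH : H ∈ A.hyperplanes) :
    Prime (A.form H) := by
  obtain ⟨φ, h, -, hφ⟩ := A.exists_linearForm_eq_form hH
  exact h ▸ prime_linearForm hφ

theorem Q_ne_zero : A.Q ≠ 0 :=
  Finset.prod_ne_zero_iff.2 fun _ hH => (A.prime_form hH).ne_zero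

theorem eq_of_form_dvd_form {H H' : Submodule K (Fin l → K)} (hH : H ∈ A.hyperplanes)
    (hH' : H' ∈ A.hyperplanes) (h : A.form H ∣ A.form H') : H = H' := by
  refine Submodule.eq_of_le_of_finrank_eq (fun v hv => ?_) ?_
  · obtain ⟨g, hg⟩ := h
    rw [A.mem_iff_eval_form H' hH', hg, map_mul, (A.mem_iff_eval_form H hH v).1 hv, zero_mul]
  · have := A.finrank_add_one H hH
    have := A.finrank_add_one H' hH'
    omega

/-- By Leibniz; for the converse, `α_H` is prime and divides no other factor of `Q`. This puts
`D(A)` in the form that the Koszul argument needs. -/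
theorem mem_logDer_iff
    (δ : Derivation K (MvPolynomial (Fin l) K) (MvPolynomial (Fin l) K)) :
    δ ∈ A.logDer ↔ A.Q ∣ δ A.Q := by
  classical
  change (∀ H ∈ A.hyperplanes, δ (A.form H) ∈ Ideal.span {A.form H}) ↔ _
  simp only [Ideal.mem_span_singleton]
  constructor
  · intro h
    rw [Q]
    have key : ∀ s : Finset (Submodule K (Fin l → K)), s ⊆ A.hyperplanes →
        ∏ H ∈ s, A.form H ∣ δ (∏ H ∈ s, A.form H) := by
      intro s
      induction s using Finset.induction_on with
      | empty => simp
      | insert H s hHs ih =>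
        intro hs
        rw [Finset.prod_insert hHs, Derivation.leibniz, smul_eq_mul, smul_eq_mul]
        refine dvd_add (mul_dvd_mul_left _ (ih ((Finset.subset_insert _ _).trans hs))) ?_
        rw [mul_comm (A.form H)]
        exact mul_dvd_mul_left _ (h H (hs (Finset.mem_insert_self _ _)))
    exact key _ subset_rfl
  · intro h H hH
    have hQ : A.Q = A.form H * ∏ H' ∈ A.hyperplanes.erase H, A.form H' :=
      (Finset.mul_prod_erase _ _ hH).symm
    have h' : A.form H ∣ δ A.Q := (Dvd.intro _ hQ.symm).trans h
    rw [hQ, Derivation.leibniz, smul_eq_mul, smul_eq_mul,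
      dvd_add_right (Dvd.intro _ rfl)] at h'
    refine ((A.prime_form hH).dvd_or_dvd h').resolve_left fun hd => ?_
    obtain ⟨H', hH', hd'⟩ := ((A.prime_form hH).dvd_finsetProd_iff _).1 hd
    obtain ⟨hne, hmem⟩ := Finset.mem_erase.1 hH'
    exact hne (A.eq_of_form_dvd_form hH hmem hd').symm

/-- A linear form vanishing on an intersection of hyperplanes lies in the ideal generated by
the corresponding forms. -/
theorem linearForm_mem_of_forall_mem {s : Finset (Submodule K (Fin l → K))}
    (hs : s ⊆ A.hyperplanes) {I : Ideal (MvPolynomial (Fin l) K)}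
    (hI : ∀ H ∈ s, A.form H ∈ I) {φ : Module.Dual K (Fin l → K)}
    (hφ : ∀ v ∈ s.inf id, φ v = 0) : linearForm φ ∈ I := by
  choose ψ hψ hker _ using fun H : s => A.exists_linearForm_eq_form (hs H.2)
  -- A functional vanishing on a finite intersection of kernels is a combination of the functionals.
  have hmem : φ ∈ Submodule.span K (Set.range ψ) := by
    refine mem_span_of_iInf_ker_le_ker fun v hv => hφ v ?_
    rw [Submodule.mem_finsetInf]
    intro H hH
    have := (Submodule.mem_iInf _).1 hv ⟨H, hH⟩
    rwa [hker] at this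
  have hle : Submodule.span K (Set.range ψ) ≤ (I.restrictScalars K).comap linearForm := by
    rw [Submodule.span_le]
    rintro _ ⟨H, rfl⟩
    change linearForm (ψ H) ∈ I
    rw [← hψ]
    exact hI _ H.2
  exact hle hmem

theorem mem_localization {X H : Submodule K (Fin l → K)} :
    H ∈ (A.localization X).hyperplanes ↔ H ∈ A.hyperplanes ∧ X ≤ H := by
  simp [localization]

/-- For a prime `P`, the intersection `X` of the hyperplanes whose forms lie in `P` is a flat with
`I(X) ≤ P`, and `Q(A)` agrees with `Q(A_X)` up to a factor outside `P`. -/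
theorem exists_Q_eq_mul (P : Ideal (MvPolynomial (Fin l) K)) [P.IsPrime] :
    ∃ X ∈ A.flats, A.flatIdeal X ≤ P ∧
      (∀ φ : Module.Dual K (Fin l → K), (∀ v ∈ X, φ v = 0) → linearForm φ ∈ A.flatIdeal X) ∧
      ∃ g ∉ P, A.Q = (A.localization X).Q * g := by
  classical
  let s := A.hyperplanes.filter fun H => A.form H ∈ P
  have hs : s ⊆ A.hyperplanes := Finset.filter_subset _ _
  have hmem (H) (hH : H ∈ A.hyperplanes) (hX : s.inf id ≤ H) : A.form H ∈ P := by
    obtain ⟨φ, h, hker, -⟩ := A.exists_linearForm_eq_form hH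
    rw [h]
    refine A.linearForm_mem_of_forall_mem hs (fun H' hH' => (Finset.mem_filter.1 hH').2)
      fun v hv => ?_
    rw [← LinearMap.mem_ker, hker]
    exact hX hv
  refine ⟨s.inf id, ⟨s, hs, rfl⟩, ?_, fun φ hφ => ?_, ?_⟩
  · rw [flatIdeal, Ideal.span_le]
    rintro _ ⟨H, ⟨hH, hX⟩, rfl⟩
    exact hmem H hH hX
  · refine A.linearForm_mem_of_forall_mem hs (fun H hH => ?_) hφ
    exact Ideal.subset_span ⟨H, ⟨hs hH, Finset.inf_le (f := id) hH⟩, rfl⟩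
  · refine ⟨∏ H ∈ A.hyperplanes.filter fun H => ¬ s.inf id ≤ H, A.form H, fun h => ?_, ?_⟩
    · obtain ⟨H, hH, hP⟩ := (Ideal.IsPrime.prod_mem_iff (p := P)).1 h
      obtain ⟨hH, hX⟩ := Finset.mem_filter.1 hH
      exact hX (Finset.inf_le (f := id) (Finset.mem_filter.2 ⟨hH, hP⟩))
    · exact (Finset.prod_filter_mul_prod_filter_not _ _ _).symm

theorem rank_add_finrank (X : Submodule K (Fin l → K)) : rank X + Module.finrank K X = l := by
  rw [rank, Submodule.finrank_quotient_add_finrank, Module.finrank_fin_fun]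

/-- At most one hyperplane contains `X`, so `Q_X` is `1` or a nonzero linear form, which has a
nonzero constant as a partial derivative. -/
theorem jacobian_localization_eq_top {X : Submodule K (Fin l → K)} (hX : rank X ≤ 1) :
    jacobian (A.localization X).Q = ⊤ := by
  have hr := rank_add_finrank X
  have heq : ∀ H ∈ (A.localization X).hyperplanes, H = X := fun H hH => by
    obtain ⟨hH, hle⟩ := A.mem_localization.1 hH
    refine (Submodule.eq_of_le_of_finrank_le hle ?_).symm
    have := A.finrank_add_one H hH
    omega
  rw [Ideal.eq_top_iff_one]
  rcases (A.localization X).hyperplanes.eq_empty_or_nonempty with h | ⟨H, hH⟩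
  · simpa [Q, h] using self_mem_jacobian (A.localization X).Q
  · have hs : (A.localization X).hyperplanes = {H} :=
      Finset.eq_singleton_iff_unique_mem.2 ⟨hH, fun H' hH' => (heq H' hH').trans (heq H hH).symm⟩
    obtain ⟨φ, h, -, hφ⟩ := (A.localization X).exists_linearForm_eq_form hH
    have hQ : (A.localization X).Q = linearForm φ := by rw [Q, hs, Finset.prod_singleton, h]
    obtain ⟨i, hi⟩ : ∃ i, φ (Pi.single i 1) ≠ 0 := by
      by_contra! hc
      refine hφ (LinearMap.ext fun v => ?_)
      rw [← sum_smul_single v]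
      simp [hc]
    have hd : pderiv i (linearForm φ) = C (φ (Pi.single i 1)) := by
      simp [linearForm_apply, pderiv_X, Pi.single_apply, smul_eq_C_mul]
    have hm := Ideal.mul_mem_left _ (C (φ (Pi.single i 1))⁻¹) (pderiv_mem_jacobian (linearForm φ) i)
    rwa [hd, ← C_mul, inv_mul_cancel₀ hi, C_1, ← hQ] at hm

/-- In coordinates adapted to a flat, the defining polynomial of the localization involves only
the coordinates that vanish on the flat. -/
theorem exists_rename_eq_localization_Q {X : Submodule K (Fin l → K)} {σ τ : Type*} [Fintype σ]
    [Fintype τ] (b : Module.Basis (σ ⊕ τ) K (Fin l → K)) (hb : ∀ i, b (Sum.inl i) ∈ X) :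
    ∃ q : MvPolynomial τ K,
      (A.localization X).Q = coordinateEquiv b (rename Sum.inr q) := by
  have h (H : (A.localization X).hyperplanes) : ∃ q : MvPolynomial τ K,
      A.form H = coordinateEquiv b (rename Sum.inr q) := by
    obtain ⟨hH, hX⟩ := A.mem_localization.1 H.2
    obtain ⟨φ, h, hker, -⟩ := A.exists_linearForm_eq_form hH
    refine ⟨∑ t, φ (b (Sum.inr t)) • MvPolynomial.X t, ?_⟩
    have h0 (i) : φ (b (Sum.inl i)) = 0 := by
      rw [← LinearMap.mem_ker, hker]
      exact hX (hb i)
    rw [h, linearForm_eq_coordinateEquiv b, Fintype.sum_sum_type]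
    simp [h0]
  choose q hq using h
  refine ⟨∏ H, q H, ?_⟩
  rw [map_prod, map_prod, Q, ← Finset.prod_coe_sort]
  exact Finset.prod_congr rfl fun H _ => hq H

/-- Splitting off the coordinates along `X` makes `J(Q_X)` an extended ideal and reduces the claim
to `mem_map_C_of_mul_mem_map_C`, with `m` the ideal of the variables vanishing on `X`. -/
theorem mem_flatIdeal_of_mul_mem_jacobian {X : Submodule K (Fin l → K)}
    (hX : ∀ φ : Module.Dual K (Fin l → K), (∀ v ∈ X, φ v = 0) → linearForm φ ∈ A.flatIdeal X)
    {f p : MvPolynomial (Fin l) K} (hf : f ∉ jacobian (A.localization X).Q)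
    (hXf : ∀ y ∈ A.flatIdeal X, y * f ∈ jacobian (A.localization X).Q)
    (hp : p * f ∈ jacobian (A.localization X).Q) : p ∈ A.flatIdeal X := by
  obtain ⟨b, hb, hb'⟩ := exists_basis_adapted X
  obtain ⟨q, hq⟩ := A.exists_rename_eq_localization_Q b hb
  let e := (coordinateEquiv b).symm.trans (sumAlgEquiv K _ _)
  have he (g : MvPolynomial (Fin l) K) : g ∈ jacobian (A.localization X).Q ↔
      e g ∈ (jacobian q).map C := by
    obtain ⟨g, rfl⟩ := (coordinateEquiv b).surjective g
    rw [hq, algEquiv_mem_jacobian_iff, ← map_sumAlgEquiv_jacobian_rename_inr]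
    simp only [e, AlgEquiv.trans_apply, AlgEquiv.symm_apply_apply]
    refine ⟨Ideal.mem_map_of_mem _, fun h => ?_⟩
    obtain ⟨g', hg', hgg⟩ := (Ideal.mem_map_of_equiv (sumAlgEquiv K _ _) _).1 h
    rwa [← (sumAlgEquiv K _ _).injective hgg]
  have hy (t) : e.symm (C (MvPolynomial.X t)) ∈ A.flatIdeal X := by
    have : e.symm (C (MvPolynomial.X t)) = linearForm (b.coord (Sum.inr t)) := by
      rw [← coordinateEquiv_X]
      simp [e, AlgEquiv.symm_trans_apply]
    rw [this]
    exact hX _ fun v hv => hb' v hv t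
  let m : Ideal (MvPolynomial (Fin (Module.finrank K ((Fin l → K) ⧸ X))) K) :=
    Ideal.span (Set.range MvPolynomial.X)
  have hm : m.map C ≤ (A.flatIdeal X).comap e.symm := by
    rw [Ideal.map_le_iff_le_comap, Ideal.span_le]
    rintro _ ⟨t, rfl⟩
    exact hy t
  have hC (r) : ∃ c : K, r - algebraMap K _ c ∈ m := by
    refine ⟨constantCoeff r, ?_⟩
    change _ ∈ Ideal.span _
    rw [← Set.image_univ, mem_ideal_span_X_image]
    intro s hs
    by_contra! h0
    obtain rfl : s = 0 := Finsupp.ext fun i => h0 i (Set.mem_univ i)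
    simp [algebraMap_eq, constantCoeff_eq] at hs
  rw [he] at hf hp
  rw [map_mul] at hp
  have := hm (mem_map_C_of_mul_mem_map_C hC hf (fun r hr => ?_) hp)
  · simpa using this
  · have h := hXf _ (hm (Ideal.mem_map_of_mem C hr))
    rw [he] at h
    simpa using h

theorem mem_jacobian_of_isFree {X : Submodule K (Fin l → K)}
    (hX : ∀ φ : Module.Dual K (Fin l → K), (∀ v ∈ X, φ v = 0) → linearForm φ ∈ A.flatIdeal X)
    (hr : 3 ≤ rank X) (hfree : (A.localization X).IsFree) {f : MvPolynomial (Fin l) K}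
    (hXf : ∀ y ∈ A.flatIdeal X, y * f ∈ jacobian (A.localization X).Q) :
    f ∈ jacobian (A.localization X).Q := by
  obtain ⟨b, hb, hb'⟩ := exists_basis_adapted X
  have hf (t) : coordinateEquiv b (MvPolynomial.X (Sum.inr t)) * f ∈
      jacobian (A.localization X).Q := by
    refine hXf _ ?_
    rw [coordinateEquiv_X]
    exact hX _ fun v hv => hb' v hv t
  have hr' : 3 ≤ Module.finrank K ((Fin l → K) ⧸ X) := hr
  have : Module.Free _ (A.localization X).logDer := hfree
  -- Rank at least three provides three coordinates vanishing on `X`, the regular sequence of the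
  -- Koszul argument.
  let t (i : Fin 3) : Fin (Module.finrank K X) ⊕ Fin (Module.finrank K ((Fin l → K) ⧸ X)) :=
    Sum.inr (Fin.castLE hr' i)
  have ht {i j : Fin 3} (h : i ≠ j) : t i ≠ t j :=
    (Sum.inr_injective.comp (Fin.castLE_injective hr')).ne h
  refine mem_jacobian_of_mul_mem (A.localization X).Q_ne_zero _ (A.localization X).mem_logDer_iff
    (y₁ := coordinateEquiv b (MvPolynomial.X (t 0)))
    ?_ (fun a h => ?_) (fun w u v h => ?_) (hf _) (hf (Fin.castLE hr' 1)) (hf (Fin.castLE hr' 2))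
  · exact (map_ne_zero_iff _ (coordinateEquiv b).injective).2 (X_ne_zero _)
  · obtain ⟨a, rfl⟩ := (coordinateEquiv b).surjective a
    rw [← map_mul, map_dvd_iff] at h
    exact map_dvd _ (X_dvd_of_dvd_X_mul (ht (by decide : (0 : Fin 3) ≠ 1)) h)
  · obtain ⟨w, rfl⟩ := (coordinateEquiv b).surjective w
    obtain ⟨u, rfl⟩ := (coordinateEquiv b).surjective u
    obtain ⟨v, rfl⟩ := (coordinateEquiv b).surjective v
    simp only [← map_mul, ← map_add] at h
    obtain ⟨u', v', rfl⟩ := exists_eq_X_mul_add_X_mul (ht (by decide : (0 : Fin 3) ≠ 2))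
      (ht (by decide : (1 : Fin 3) ≠ 2)) ((coordinateEquiv b).injective h)
    exact ⟨coordinateEquiv b u', coordinateEquiv b v', by simp [t]⟩

end CentralArrangement

theorem corollary4p3 {K : Type*} [Field K] [CharZero K] {l : ℕ} (A : CentralArrangement K l) :
    associatedPrimes (MvPolynomial (Fin l) K) (MvPolynomial (Fin l) K ⧸ A.jacobianIdeal) ⊆
      {P | ∃ X ∈ A.flats, CentralArrangement.rank X = 2 ∧ P = A.flatIdeal X} ∪
      {P | ∃ X ∈ A.flats, 3 ≤ CentralArrangement.rank X ∧
        ¬ (A.localization X).IsFree ∧ P = A.flatIdeal X} := by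
  rintro P hP
  obtain ⟨hprime, f, hf⟩ := Submodule.isAssociatedPrime_iff.1 (AssociatedPrimes.mem_iff.1 hP)
  obtain ⟨f, rfl⟩ := Ideal.Quotient.mk_surjective f
  have hPf (p : MvPolynomial (Fin l) K) : p ∈ P ↔ p * f ∈ jacobian A.Q := by
    rw [hf, Submodule.mem_colon_singleton, Submodule.mem_bot]
    exact Ideal.Quotient.eq_zero_iff_mem (a := p * f)
  obtain ⟨X, hX, hle, hlin, g, hg, hQ⟩ := A.exists_Q_eq_mul P
  have hg2 : g ^ 2 ∉ P := fun h => hg (hprime.mem_of_pow_mem 2 h)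
  -- The factor `g ^ 2` lost in comparing the two Jacobian ideals is harmless because it lies
  -- outside `P`.
  have hPf' (p : MvPolynomial (Fin l) K) : p ∈ P ↔ p * f ∈ jacobian (A.localization X).Q := by
    refine ⟨fun h => jacobian_mul_le _ g (hQ ▸ (hPf p).1 h), fun h => ?_⟩
    refine (hprime.mem_or_mem ((hPf (g ^ 2 * p)).2 ?_)).resolve_left hg2
    rw [hQ, mul_assoc]
    exact sq_mul_mem_jacobian_mul g h
  have hf' : f ∉ jacobian (A.localization X).Q := fun h =>
    hprime.ne_top ((Ideal.eq_top_iff_one P).2 ((hPf' 1).2 (by rwa [one_mul])))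
  have hXf (y) (hy : y ∈ A.flatIdeal X) : y * f ∈ jacobian (A.localization X).Q :=
    (hPf' y).1 (hle hy)
  have hPX : P = A.flatIdeal X := le_antisymm
    (fun p hp => A.mem_flatIdeal_of_mul_mem_jacobian hlin hf' hXf ((hPf' p).1 hp)) hle
  have hrank : 1 < CentralArrangement.rank X := by
    by_contra! h
    exact hf' (A.jacobian_localization_eq_top h ▸ Submodule.mem_top)
  rcases (Nat.succ_le_of_lt hrank).eq_or_lt with h | h
  · exact Or.inl ⟨X, hX, h.symm, hPX⟩
  · exact Or.inr ⟨X, hX, h, fun hfree => hf' (A.mem_jacobian_of_isFree hlin h hfree hXf), hPX⟩
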